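/- All graphs are finite and simple. For a graph $G$ of order $n$ let $m(G,k)$ be the number of $k$-matchings of $G$ (sets of $k$ pairwise nonincident edges), and let $\mu(G,x)=\sum_{k\ge 0}(-1)^k m(G,k)\,x^{n-2k}$ be its matching polynomial. Two nonisomorphic graphs with the same matching polynomial are called comatching, and a graph is called matching unique if it has no comatching graph. For a positive integer $t$, let $L(t,2)$ be the graph obtained from $K_3\cup tK_1$ by adding a new vertex adjacent to all $t$ isolated vertices and to exactly two vertices of the triangle. For integers $k\ge\ell\ge0$ and $t\ge0$, let $K'(k,t;\ell)$ be the graph obtained from $K_{1,k}\cup tK_1$ by adding a new vertex adjacent to all $t$ isolated vertices, to the center of the star and to exactly $\ell$ of its leaves. Theorem. For every positive integer $t$, the graph $L(t,2)$ is matching unique if and only if $t\notin\{1,2,4,5,6\}$. For the exceptional values of $t$: - $L(1,2)$ is comatching with the graph consisting of two triangles that share exactly one vertex; - $L(2,2)$ is comatching with $B\cup K_1$, where $B$ is $K_{2,3}$ with one further edge joining two vertices of the part of size three; - $L(4,2)$ is comatching with $K'(4,2;2)$; - $L(5,2)$ is comatching with $K'(4,2;3)\cup K_1$; - $L(6,2)$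 is comatching with $K'(4,2;4)\cup 2K_1$ and with $K'(5,0;5)\cup 3K_1$. -/

import Mathlib

open scoped SimpleGraph

namespace MatchingGraphs

/-- `M` is a matching of `G`: a set of pairwise nonincident edges of `G`. -/
def IsMatchingOf {V : Type*} (G : SimpleGraph V) (M : Finset (Sym2 V)) : Prop :=
  (∀ e ∈ M, e ∈ G.edgeSet) ∧ ∀ e ∈ M, ∀ f ∈ M, e ≠ f → ∀ v, v ∈ e → v ∉ f

/-- `m(G, k)`: the number of `k`-matchings of `G`. -/
noncomputable def numMatchings {V : Type*} (G : SimpleGraph V) (k : ℕ) : ℕ :=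
  Set.ncard {M : Finset (Sym2 V) | M.card = k ∧ IsMatchingOf G M}

/-- The matching polynomial `∑ (-1)^k m(G, k) x^(n - 2k)`. The sum runs over `2k ≤ n`, as there is
no `k`-matching when `2k > n`. -/
noncomputable def matchingPoly {V : Type*} [Fintype V] (G : SimpleGraph V) : Polynomial ℤ :=
  ∑ k ∈ Finset.range (Fintype.card V / 2 + 1),
    Polynomial.C ((-1 : ℤ) ^ k * (numMatchings G k : ℤ)) *
      Polynomial.X ^ (Fintype.card V - 2 * k)

/-- Two nonisomorphic graphs with the same matching polynomial. -/
def Comatching {V W : Type*} [Fintype V] [Fintype W]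
    (G : SimpleGraph V) (H : SimpleGraph W) : Prop :=
  IsEmpty (G ≃g H) ∧ matchingPoly G = matchingPoly H

/-- `G` has no comatching graph. Every finite graph is isomorphic to one whose vertices form a
type in `Type`, so it is enough to let `W` range over `Type`. -/
def MatchingUnique {V : Type*} [Fintype V] (G : SimpleGraph V) : Prop :=
  ∀ (W : Type) [Fintype W] (H : SimpleGraph W), ¬ Comatching G H

/-- The graph obtained from `G` by adding one new vertex `none`, joined to the vertices in `S`. -/
def addVertex {V : Type*} (G : SimpleGraph V) (S : Set V) : SimpleGraph (Option V) where
  Adj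
    | none, none => False
    | none, some v => v ∈ S
    | some v, none => v ∈ S
    | some v, some w => G.Adj v w
  symm := ⟨by
    rintro (_ | v) (_ | w) h
    · exact h
    · exact h
    · exact h
    · exact G.adj_symm h⟩
  loopless := ⟨by
    rintro (_ | v) h
    · exact h
    · exact G.loopless.irrefl v h⟩

/-- `n K₁`: the graph with `n` vertices and no edges. -/
abbrev isolated (n : ℕ) : SimpleGraph (Fin n) := ⊥

/-- `L(t, ℓ)` for `1 ≤ ℓ ≤ 3`: a new vertex is added to `K₃ ∪ tK₁` and joined to all `t` isolated
vertices and to `ℓ` vertices of the triangle. -/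
def graphL (t ℓ : ℕ) : SimpleGraph (Option (Fin 3 ⊕ Fin t)) :=
  addVertex ((⊤ : SimpleGraph (Fin 3)) ⊕g isolated t)
    {x | match x with
      | .inl i => i.val < ℓ
      | .inr _ => True}

/-- `K'(k, t; ℓ)` for `ℓ ≤ k`: a new vertex is added to `K_{1,k} ∪ tK₁` and joined to all `t`
isolated vertices, to the center of the star and to `ℓ` of its leaves. -/
def graphK' (k t ℓ : ℕ) : SimpleGraph (Option ((Fin 1 ⊕ Fin k) ⊕ Fin t)) :=
  addVertex (completeBipartiteGraph (Fin 1) (Fin k) ⊕g isolated t)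
    {x | match x with
      | .inl (.inl _) => True
      | .inl (.inr i) => i.val < ℓ
      | .inr _ => True}

/-- Two triangles sharing exactly one vertex: a new vertex joined to all vertices of `2K₂`. -/
def bowtie : SimpleGraph (Option (Fin 2 ⊕ Fin 2)) :=
  addVertex ((⊤ : SimpleGraph (Fin 2)) ⊕g (⊤ : SimpleGraph (Fin 2))) Set.univ

/-- `K_{2,3}` with one more edge, joining two vertices of the part of size three. -/
def bipartitePlusEdge : SimpleGraph (Fin 2 ⊕ Fin 3) :=
  completeBipartiteGraph (Fin 2) (Fin 3) ⊔ SimpleGraph.edge (.inr 0) (.inr 1)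

end MatchingGraphs

open MatchingGraphs

/-! Every edge of L(t,2) meets the added vertex or lies in the triangle, so L(t,2) has no
3-matching. Among graphs without 3-matchings the matching polynomial carries the order, the number
of edges and m(G,2). Since two distinct edges are either disjoint or share exactly one vertex, this
is the same information as the order, ∑ deg and ∑ C(deg,2). Comatching in the exceptional cases is
thus a comparison of degree sums.

For uniqueness, let H share the polynomial of L(t,2), with t = 3 or t ≥ 7. Then m(H,3) = 0 and
m(H,2) ≠ 0, and an augmentation argument around two disjoint edges (`NoThreeMatching.shape`) leaves
four shapes: all edges are covered by two vertices; all edges meet one vertex or lie in a triangle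
avoiding it; all edges lie within five vertices; all edges lie in two triples. The last two fail by
degree bounds. The first becomes a Diophantine equation whose positive solutions have t = 4, 5, 6
(`cover_arith`). In the second the degree sums force L(t,2) itself (`HasLData.nonempty_iso`). -/

namespace MatchingGraphs

/-- No three edges of `G` are pairwise disjoint. -/
def NoThreeMatching {V : Type*} (G : SimpleGraph V) : Prop :=
  ∀ a b c d x y, G.Adj a b → G.Adj c d → G.Adj x y →
    a ≠ c → a ≠ d → b ≠ c → b ≠ d → a ≠ x → a ≠ y → b ≠ x → b ≠ y →
    c ≠ x → c ≠ y → d ≠ x → d ≠ y → False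

/-! ### Small matchings counted through edges and degrees. -/

section Counting

variable {V : Type*} (G : SimpleGraph V)

theorem numMatchings_zero : numMatchings G 0 = 1 := by
  rw [numMatchings, Set.ncard_eq_one]
  refine ⟨∅, ?_⟩
  ext M
  simp only [Finset.card_eq_zero, Set.mem_ofPred_eq, Set.mem_singleton_iff]
  constructor
  · exact fun h => h.1
  · rintro rfl
    simp [IsMatchingOf]

theorem numMatchings_one [Fintype G.edgeSet] : numMatchings G 1 = G.edgeFinset.card := by
  classical
  rw [numMatchings, ← Finset.card_image_of_injective G.edgeFinset
    (Finset.singleton_injective (α := Sym2 V)), ← Set.ncard_coe_finset]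
  congr 1
  ext M
  simp only [Finset.card_eq_one, Set.mem_ofPred_eq, Finset.coe_image, Set.mem_image,
    SimpleGraph.coe_edgeFinset]
  constructor
  · rintro ⟨⟨e, rfl⟩, h⟩
    exact ⟨e, h.1 e (by simp), rfl⟩
  · rintro ⟨e, he, rfl⟩
    refine ⟨⟨e, rfl⟩, by simpa using he, ?_⟩
    intro x hx y hy hxy
    simp only [Finset.mem_singleton] at hx hy
    exact absurd (hx.trans hy.symm) hxy

variable [Fintype V] [DecidableEq V] [DecidableRel G.Adj]

/-- A pair of distinct edges is either a matching or meets in exactly one vertex. -/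
theorem numMatchings_two_add_sum_choose :
    numMatchings G 2 + ∑ v, (G.degree v).choose 2 = G.edgeFinset.card.choose 2 := by
  classical
  set P := G.edgeFinset.powersetCard 2 with hP
  have hm : numMatchings G 2 = (P.filter (IsMatchingOf G)).card := by
    rw [numMatchings, ← Set.ncard_coe_finset]
    congr 1
    ext M
    simp only [Set.mem_ofPred_eq, Finset.coe_filter, hP, Finset.mem_powersetCard]
    constructor
    · rintro ⟨h1, h2⟩
      exact ⟨⟨fun e he => by simpa using h2.1 e he, h1⟩, h2⟩
    · rintro ⟨⟨_, h1⟩, h2⟩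
      exact ⟨h1, h2⟩
  have hn : (P.filter fun M => ¬ IsMatchingOf G M).card = ∑ v, (G.degree v).choose 2 := by
    have : (P.filter fun M => ¬ IsMatchingOf G M) =
        Finset.univ.biUnion fun v => (G.incidenceFinset v).powersetCard 2 := by
      ext M
      simp only [hP, Finset.mem_filter, Finset.mem_powersetCard, Finset.mem_biUnion,
        Finset.mem_univ, true_and]
      constructor
      · rintro ⟨⟨h1, h2⟩, h3⟩
        rw [IsMatchingOf, not_and] at h3
        have h4 := h3 fun e he => by simpa using h1 he
        push Not at h4
        obtain ⟨e, he, f, hf, hef, v, hve, hvf⟩ := h4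
        refine ⟨v, ?_, h2⟩
        have hM : M = {e, f} := by
          symm
          apply Finset.eq_of_subset_of_card_le
          · intro x hx
            simp only [Finset.mem_insert, Finset.mem_singleton] at hx
            rcases hx with rfl | rfl <;> assumption
          · rw [h2, Finset.card_pair hef]
        intro x hx
        rw [SimpleGraph.mem_incidenceFinset]
        refine ⟨by simpa using h1 hx, ?_⟩
        rw [hM] at hx
        simp only [Finset.mem_insert, Finset.mem_singleton] at hx
        rcases hx with rfl | rfl <;> assumption
      · rintro ⟨v, h1, h2⟩
        refine ⟨⟨fun e he => by
          have := h1 he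
          rw [SimpleGraph.mem_incidenceFinset] at this
          simpa using this.1, h2⟩, fun h => ?_⟩
        obtain ⟨e, f, hef, rfl⟩ := Finset.card_eq_two.1 h2
        have he := h1 (Finset.mem_insert_self e _)
        have hf := h1 (show f ∈ ({e, f} : Finset _) by simp)
        rw [SimpleGraph.mem_incidenceFinset] at he hf
        exact h.2 e (by simp) f (by simp) hef v he.2 hf.2
    rw [this, Finset.card_biUnion]
    · simp
    · intro v _ w _ hvw
      rw [Function.onFun, Finset.disjoint_left]
      intro M hv hw
      rw [Finset.mem_powersetCard] at hv hw
      obtain ⟨e, f, hef, rfl⟩ := Finset.card_eq_two.1 hv.2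
      -- Two distinct edges cannot share two vertices, so each non-matching pair is counted at a
      -- single vertex.
      have key : ∀ x ∈ ({e, f} : Finset (Sym2 V)), x = s(v, w) := by
        intro x hx
        have h1 := hv.1 hx
        have h2 := hw.1 hx
        rw [SimpleGraph.mem_incidenceFinset] at h1 h2
        exact (Sym2.mem_and_mem_iff hvw).1 ⟨h1.2, h2.2⟩
      exact hef ((key e (by simp)).trans (key f (by simp)).symm)
  rw [hm, ← hn, Finset.card_filter_add_card_filter_not, hP, Finset.card_powersetCard]

end Counting

/-! ### Matchings as explicit disjoint edges. -/

variable {V : Type*} {G : SimpleGraph V}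

theorem IsMatchingOf.exists_adj {M : Finset (Sym2 V)} (hM : IsMatchingOf G M) {e f : Sym2 V}
    (he : e ∈ M) (hf : f ∈ M) (hef : e ≠ f) :
    ∃ a b c d, e = s(a, b) ∧ f = s(c, d) ∧ G.Adj a b ∧ G.Adj c d ∧
      a ≠ c ∧ a ≠ d ∧ b ≠ c ∧ b ≠ d := by
  induction e with | _ a b =>
  induction f with | _ c d =>
  have h1 := hM.2 _ he _ hf hef a (by simp)
  have h2 := hM.2 _ he _ hf hef b (by simp)
  simp only [Sym2.mem_iff, not_or] at h1 h2
  exact ⟨a, b, c, d, rfl, rfl, by simpa using hM.1 _ he, by simpa using hM.1 _ hf,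
    h1.1, h1.2, h2.1, h2.2⟩

theorem NoThreeMatching.numMatchings_eq_zero (h : NoThreeMatching G) {k : ℕ} (hk : 3 ≤ k) :
    numMatchings G k = 0 := by
  classical
  by_contra h0
  obtain ⟨M, hc, hM⟩ := Set.nonempty_of_ncard_ne_zero h0
  obtain ⟨N, hN, hN3⟩ := Finset.exists_subset_card_eq (hc ▸ hk : 3 ≤ M.card)
  obtain ⟨e, f, g, hef, heg, hfg, rfl⟩ := Finset.card_eq_three.1 hN3
  have he : e ∈ M := hN (by simp)
  have hf : f ∈ M := hN (by simp)
  have hg : g ∈ M := hN (by simp)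
  induction e with | _ a b =>
  induction f with | _ c d =>
  induction g with | _ x y =>
  have h1 := hM.2 _ he _ hf hef
  have h2 := hM.2 _ he _ hg heg
  have h3 := hM.2 _ hf _ hg hfg
  simp only [Sym2.mem_iff, not_or, forall_eq_or_imp, forall_eq] at h1 h2 h3
  exact h a b c d x y (by simpa using hM.1 _ he) (by simpa using hM.1 _ hf)
    (by simpa using hM.1 _ hg) h1.1.1 h1.1.2 h1.2.1 h1.2.2 h2.1.1 h2.1.2 h2.2.1 h2.2.2
    h3.1.1 h3.1.2 h3.2.1 h3.2.2

theorem exists_disjoint_adj_of_numMatchings_two (h : numMatchings G 2 ≠ 0) :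
    ∃ a b c d, G.Adj a b ∧ G.Adj c d ∧ a ≠ c ∧ a ≠ d ∧ b ≠ c ∧ b ≠ d := by
  classical
  obtain ⟨M, hc, hM⟩ := Set.nonempty_of_ncard_ne_zero h
  obtain ⟨e, f, hef, rfl⟩ := Finset.card_eq_two.1 hc
  obtain ⟨a, b, c, d, -, -, h⟩ := hM.exists_adj (e := e) (f := f) (by simp) (by simp) hef
  exact ⟨a, b, c, d, h⟩

theorem noThreeMatching_of_numMatchings [Fintype V] (h : numMatchings G 3 = 0) :
    NoThreeMatching G := by
  classical
  intro a b c d x y hab hcd hxy h1 h2 h3 h4 h5 h6 h7 h8 h9 h10 h11 h12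
  rw [numMatchings, Set.ncard_eq_zero (Set.toFinite _)] at h
  have : ({s(a, b), s(c, d), s(x, y)} : Finset (Sym2 V)) ∈
      {M : Finset (Sym2 V) | M.card = 3 ∧ IsMatchingOf G M} := by
    refine ⟨?_, ?_, ?_⟩
    · rw [Finset.card_eq_three]
      refine ⟨_, _, _, ?_, ?_, ?_, rfl⟩ <;> simp [*]
    · simp [*]
    · simp only [Finset.mem_insert, Finset.mem_singleton]
      rintro e (rfl | rfl | rfl) f (rfl | rfl | rfl) hef v hv <;>
        simp only [Sym2.mem_iff, not_or, ne_eq, not_true_eq_false] at hef hv ⊢ <;>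
        rcases hv with rfl | rfl <;> simp [*, Ne.symm]
  rw [h] at this
  exact this

/-! ### What the matching polynomial determines. -/

section Poly

variable {W : Type*} [Fintype V] [Fintype W]

theorem coeff_matchingPoly (G : SimpleGraph V) {k : ℕ} (hk : 2 * k ≤ Fintype.card V) :
    (matchingPoly G).coeff (Fintype.card V - 2 * k) = (-1) ^ k * (numMatchings G k : ℤ) := by
  rw [matchingPoly, Polynomial.finsetSum_coeff, Finset.sum_eq_single k]
  · simp only [Polynomial.coeff_C_mul, Polynomial.coeff_X_pow, if_true, mul_one]
  · intro j hj hjk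
    rw [Finset.mem_range] at hj
    -- The truncated subtraction is harmless: both 2j and 2k are at most the order, so distinct
    -- indices give distinct exponents.
    rw [Polynomial.coeff_C_mul, Polynomial.coeff_X_pow, if_neg (by omega), mul_zero]
  · intro h
    rw [Finset.mem_range] at h
    omega

theorem natDegree_matchingPoly (G : SimpleGraph V) :
    (matchingPoly G).natDegree = Fintype.card V := by
  apply Polynomial.natDegree_eq_of_le_of_coeff_ne_zero
  · rw [matchingPoly]
    apply Polynomial.natDegree_sum_le_of_forall_le
    intro k _
    exact (Polynomial.natDegree_C_mul_X_pow_le _ _).trans (Nat.sub_le _ _)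
  · have := coeff_matchingPoly G (k := 0) (by simp)
    simp only [mul_zero, Nat.sub_zero, pow_zero, one_mul, numMatchings_zero] at this
    simp [this]

theorem card_eq_of_matchingPoly_eq {G : SimpleGraph V} {H : SimpleGraph W}
    (h : matchingPoly G = matchingPoly H) : Fintype.card V = Fintype.card W := by
  rw [← natDegree_matchingPoly G, h, natDegree_matchingPoly]

theorem numMatchings_eq_of_matchingPoly_eq {G : SimpleGraph V} {H : SimpleGraph W}
    (h : matchingPoly G = matchingPoly H) {k : ℕ} (hk : 2 * k ≤ Fintype.card V) :
    numMatchings G k = numMatchings H k := by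
  have hc := card_eq_of_matchingPoly_eq h
  have h1 := coeff_matchingPoly G hk
  rw [h, hc, coeff_matchingPoly H (hc ▸ hk)] at h1
  have := mul_left_cancel₀ (pow_ne_zero k (by norm_num)) h1
  exact_mod_cast this.symm

theorem matchingPoly_eq_of_numMatchings_eq {G : SimpleGraph V} {H : SimpleGraph W}
    (hc : Fintype.card V = Fintype.card W) (h : ∀ k, numMatchings G k = numMatchings H k) :
    matchingPoly G = matchingPoly H := by
  simp only [matchingPoly, hc, h]

/-- Without 3-matchings only m(G,0), m(G,1) and m(G,2) can be nonzero, and the degree sums fix the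
last two. -/
theorem matchingPoly_eq_of_degrees [DecidableEq V] [DecidableEq W]
    {G : SimpleGraph V} {H : SimpleGraph W} [DecidableRel G.Adj] [DecidableRel H.Adj]
    (hc : Fintype.card V = Fintype.card W)
    (h1 : ∑ v, G.degree v = ∑ w, H.degree w)
    (h2 : ∑ v, (G.degree v).choose 2 = ∑ w, (H.degree w).choose 2)
    (hG : NoThreeMatching G) (hH : NoThreeMatching H) : matchingPoly G = matchingPoly H := by
  have he : G.edgeFinset.card = H.edgeFinset.card := by
    rw [G.sum_degrees_eq_twice_card_edges, H.sum_degrees_eq_twice_card_edges] at h1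
    omega
  refine matchingPoly_eq_of_numMatchings_eq hc fun k => ?_
  match k with
  | 0 => rw [numMatchings_zero, numMatchings_zero]
  | 1 => rw [numMatchings_one, numMatchings_one, he]
  | 2 =>
    have h3 := numMatchings_two_add_sum_choose G
    have h4 := numMatchings_two_add_sum_choose H
    rw [he] at h3
    omega
  | k + 3 => rw [hG.numMatchings_eq_zero (by omega), hH.numMatchings_eq_zero (by omega)]

end Poly


/-! ### Graphs with two, but not three, pairwise disjoint edges. -/

section Structure

variable {V : Type*} {G : SimpleGraph V}

/-- If the disjoint edges `ab` and `cd` form a maximum matching, then either one end of `ab` has no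
neighbor outside of the matching, or all such neighbors of `a` and `b` are a single vertex. -/
theorem NoThreeMatching.outer_neighbors (h : NoThreeMatching G) {a b c d : V}
    (hab : G.Adj a b) (hcd : G.Adj c d) (hac : a ≠ c) (had : a ≠ d) (hbc : b ≠ c) (hbd : b ≠ d) :
    (∀ x, G.Adj b x → x = a ∨ x = c ∨ x = d) ∨ (∀ x, G.Adj a x → x = b ∨ x = c ∨ x = d) ∨
      ∃ x, G.Adj a x ∧ G.Adj b x ∧ x ≠ c ∧ x ≠ d ∧
        (∀ y, G.Adj a y → y = b ∨ y = c ∨ y = d ∨ y = x) ∧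
        (∀ y, G.Adj b y → y = a ∨ y = c ∨ y = d ∨ y = x) := by
  by_contra! hcon
  obtain ⟨⟨x, hbx, hxa, hxc, hxd⟩, ⟨y, hay, hyb, hyc, hyd⟩, h3⟩ := hcon
  -- Distinct outer neighbors y of a and z of b would augment: ay, bz, cd are disjoint.
  have key : ∀ y z, G.Adj a y → y ≠ b → y ≠ c → y ≠ d → G.Adj b z → z ≠ a → z ≠ c → z ≠ d →
      y = z := by
    intro y z hy1 hy2 hy3 hy4 hz1 hz2 hz3 hz4
    by_contra hyz
    exact h a y b z c d hy1 hz1 hcd hab.ne hz2.symm hy2 hyz hac had hy3 hy4 hbc hbd hz3 hz4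
  obtain rfl := key y x hay hyb hyc hyd hbx hxa hxc hxd
  obtain ⟨z, hz⟩ := h3 y hay hbx hxc hxd (fun z hz => by
    by_contra! hh
    exact hh.2.2.2 (key z y hz hh.1 hh.2.1 hh.2.2.1 hbx hxa hxc hxd))
  exact hz.2.2.2.2 (key y z hay hyb hyc hyd hz.1 hz.2.1 hz.2.2.1 hz.2.2.2.1).symm

/-- The four shapes of a graph without three pairwise disjoint edges. -/
def SmallMatchingShape (G : SimpleGraph V) : Prop :=
  (∃ u v, ∀ x y, G.Adj x y → x = u ∨ x = v ∨ y = u ∨ y = v) ∨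
  (∃ v p q r, v ≠ p ∧ v ≠ q ∧ v ≠ r ∧ p ≠ q ∧ p ≠ r ∧ q ≠ r ∧
    ∀ x y, G.Adj x y → x = v ∨ y = v ∨ ((x = p ∨ x = q ∨ x = r) ∧ (y = p ∨ y = q ∨ y = r))) ∨
  (∃ a b c d x, ∀ y z, G.Adj y z → y = a ∨ y = b ∨ y = c ∨ y = d ∨ y = x) ∨
  (∃ a b c p q r, ∀ x y, G.Adj x y →
    ((x = a ∨ x = b ∨ x = c) ∧ (y = a ∨ y = b ∨ y = c)) ∨
    ((x = p ∨ x = q ∨ x = r) ∧ (y = p ∨ y = q ∨ y = r)))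

variable {a b c d : V}

theorem NoThreeMatching.edge_meets (h : NoThreeMatching G)
    (hab : G.Adj a b) (hcd : G.Adj c d) (hac : a ≠ c) (had : a ≠ d) (hbc : b ≠ c) (hbd : b ≠ d)
    {x y : V} (hxy : G.Adj x y) :
    x = a ∨ x = b ∨ x = c ∨ x = d ∨ y = a ∨ y = b ∨ y = c ∨ y = d := by
  by_contra! hh
  obtain ⟨h1, h2, h3, h4, h5, h6, h7, h8⟩ := hh
  exact h a b c d x y hab hcd hxy hac had hbc hbd h1.symm h5.symm h2.symm h6.symm h3.symm h7.symm
    h4.symm h8.symm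

/-- If b and d are not adjacent, a and c cover all edges. Otherwise bd can join a third matching:
outer neighbors of both a and c must coincide, which leaves five vertices. If a or c has none, the
other is the center of the star-and-triangle shape. -/
theorem NoThreeMatching.shape_of_two_ends (h : NoThreeMatching G)
    (hab : G.Adj a b) (hcd : G.Adj c d) (hac : a ≠ c) (had : a ≠ d) (hbc : b ≠ c) (hbd : b ≠ d)
    (hb : ∀ x, G.Adj b x → x = a ∨ x = c ∨ x = d) (hd : ∀ x, G.Adj d x → x = a ∨ x = b ∨ x = c) :
    SmallMatchingShape G := by
  have hm := fun x y => h.edge_meets hab hcd hac had hbc hbd (x := x) (y := y)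
  by_cases hbd' : G.Adj b d
  swap
  · refine Or.inl ⟨a, c, fun x y hxy => ?_⟩
    grind [G.adj_comm]
  by_cases hA : ∃ x, G.Adj a x ∧ x ≠ b ∧ x ≠ c ∧ x ≠ d
  swap
  · refine Or.inr (Or.inl ⟨c, a, b, d, hac.symm, hbc.symm, hcd.ne, hab.ne, had, hbd, ?_⟩)
    grind [G.adj_comm]
  by_cases hC : ∃ x, G.Adj c x ∧ x ≠ a ∧ x ≠ b ∧ x ≠ d
  swap
  · refine Or.inr (Or.inl ⟨a, b, c, d, hab.ne, hac, had, hbc, hbd, hcd.ne, ?_⟩)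
    grind [G.adj_comm]
  have key : ∀ x y, G.Adj a x → x ≠ b → x ≠ c → x ≠ d → G.Adj c y → y ≠ a → y ≠ b → y ≠ d →
      x = y := by
    intro x y hx1 hx2 hx3 hx4 hy1 hy2 hy3 hy4
    by_contra hxy
    exact h a x c y b d hx1 hy1 hbd' hac hy2.symm hx3 hxy hab.ne had hx2 hx4 hbc.symm hcd.ne hy3 hy4
  obtain ⟨x, hx⟩ := hA
  refine Or.inr (Or.inr (Or.inl ⟨a, b, c, d, x, ?_⟩))
  grind [G.adj_comm]

/-- If c has a neighbor x beyond a, b, d, w, then cx together with an edge from d to the triangle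
abw and the opposite triangle edge would be disjoint. So d hangs on c alone, and c is the center. -/
theorem NoThreeMatching.shape_of_triangle (h : NoThreeMatching G) {w : V}
    (hab : G.Adj a b) (hcd : G.Adj c d) (hac : a ≠ c) (had : a ≠ d) (hbc : b ≠ c) (hbd : b ≠ d)
    (haw : G.Adj a w) (hbw : G.Adj b w) (hwc : w ≠ c) (hwd : w ≠ d)
    (ha : ∀ y, G.Adj a y → y = b ∨ y = c ∨ y = d ∨ y = w)
    (hb : ∀ y, G.Adj b y → y = a ∨ y = c ∨ y = d ∨ y = w)
    (hd : ∀ x, G.Adj d x → x = a ∨ x = b ∨ x = c) :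
    SmallMatchingShape G := by
  have hm := fun x y => h.edge_meets hab hcd hac had hbc hbd (x := x) (y := y)
  by_cases hC : ∃ x, G.Adj c x ∧ x ≠ a ∧ x ≠ b ∧ x ≠ d ∧ x ≠ w
  swap
  · refine Or.inr (Or.inr (Or.inl ⟨a, b, c, d, w, ?_⟩))
    grind [G.adj_comm]
  obtain ⟨x, hcx, hxa, hxb, hxd, hxw⟩ := hC
  have had' : ¬ G.Adj a d := fun hh =>
    h b w a d c x hbw hh hcx hab.ne.symm hbd haw.ne.symm hwd hbc hxb.symm hwc hxw.symm hac
      hxa.symm hcd.ne.symm hxd.symm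
  have hbd' : ¬ G.Adj b d := fun hh =>
    h a w b d c x haw hh hcx hab.ne had hbw.ne.symm hwd hac hxa.symm hwc hxw.symm hbc
      hxb.symm hcd.ne.symm hxd.symm
  refine Or.inr (Or.inl ⟨c, a, b, w, hac.symm, hbc.symm, hwc.symm, hab.ne, haw.ne, hbw.ne, ?_⟩)
  grind [G.adj_comm]

/-- An edge joining two disjoint triangles leaves a disjoint edge in each of them. -/
theorem NoThreeMatching.shape_of_two_triangles (h : NoThreeMatching G) {w z : V}
    (hab : G.Adj a b) (hcd : G.Adj c d) (hac : a ≠ c) (had : a ≠ d) (hbc : b ≠ c) (hbd : b ≠ d)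
    (haw : G.Adj a w) (hbw : G.Adj b w) (hwc : w ≠ c) (hwd : w ≠ d)
    (ha : ∀ y, G.Adj a y → y = b ∨ y = c ∨ y = d ∨ y = w)
    (hb : ∀ y, G.Adj b y → y = a ∨ y = c ∨ y = d ∨ y = w)
    (hcz : G.Adj c z) (hdz : G.Adj d z) (hza : z ≠ a) (hzb : z ≠ b)
    (hc : ∀ y, G.Adj c y → y = d ∨ y = a ∨ y = b ∨ y = z)
    (hd : ∀ y, G.Adj d y → y = c ∨ y = a ∨ y = b ∨ y = z) :
    SmallMatchingShape G := by
  have hm := fun x y => h.edge_meets hab hcd hac had hbc hbd (x := x) (y := y)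
  by_cases hwz : w = z
  · refine Or.inr (Or.inr (Or.inl ⟨a, b, c, d, w, ?_⟩))
    grind [G.adj_comm]
  have h1 : ¬ G.Adj a c := fun hh => by
    apply h b w d z a c <;> grind [G.adj_comm, SimpleGraph.Adj.ne]
  have h2 : ¬ G.Adj a d := fun hh => by
    apply h b w c z a d <;> grind [G.adj_comm, SimpleGraph.Adj.ne]
  have h3 : ¬ G.Adj b c := fun hh => by
    apply h a w d z b c <;> grind [G.adj_comm, SimpleGraph.Adj.ne]
  have h4 : ¬ G.Adj b d := fun hh => by
    apply h a w c z b d <;> grind [G.adj_comm, SimpleGraph.Adj.ne]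
  refine Or.inr (Or.inr (Or.inr ⟨a, b, w, c, d, z, ?_⟩))
  grind [G.adj_comm]

/-- Each of the two edges has three possible outer behaviors; swapping ends and edges reduces the
nine combinations to the three lemmas above. -/
theorem NoThreeMatching.shape (h : NoThreeMatching G)
    (hab : G.Adj a b) (hcd : G.Adj c d) (hac : a ≠ c) (had : a ≠ d) (hbc : b ≠ c) (hbd : b ≠ d) :
    SmallMatchingShape G := by
  rcases h.outer_neighbors hab hcd hac had hbc hbd with h1 | h1 | ⟨w, w1, w2, w3, w4, w5, w6⟩ <;>
  rcases h.outer_neighbors hcd hab hac.symm hbc.symm had.symm hbd.symm with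
    h2 | h2 | ⟨z, z1, z2, z3, z4, z5, z6⟩
  · exact h.shape_of_two_ends hab hcd hac had hbc hbd h1 (by grind)
  · exact h.shape_of_two_ends hab hcd.symm had hac hbd hbc (by grind) (by grind)
  · exact h.shape_of_triangle hcd hab hac.symm hbc.symm had.symm hbd.symm z1 z2 z3 z4 z5 z6
      (by grind)
  · exact h.shape_of_two_ends hab.symm hcd hbc hbd hac had h1 (by grind)
  · exact h.shape_of_two_ends hab.symm hcd.symm hbd hbc had hac (by grind) (by grind)
  · exact h.shape_of_triangle hcd hab.symm hbc.symm hac.symm hbd.symm had.symm z1 z2 z4 z3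
      (by grind) (by grind) (by grind)
  · exact h.shape_of_triangle hab hcd hac had hbc hbd w1 w2 w3 w4 w5 w6 (by grind)
  · exact h.shape_of_triangle hab hcd.symm had hac hbd hbc w1 w2 w4 w3
      (by grind) (by grind) (by grind)
  · exact h.shape_of_two_triangles hab hcd hac had hbc hbd w1 w2 w3 w4 w5 w6 z1 z2 z3 z4 z5 z6

end Structure

/-! ### Degrees of L(t,2) and the exceptional comatching pairs. -/

section Concrete

instance {V : Type*} (G : SimpleGraph V) (S : Set V) [DecidableRel G.Adj]
    [DecidablePred (· ∈ S)] : DecidableRel (addVertex G S).Adj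
  | none, none => inferInstanceAs (Decidable False)
  | none, some v => inferInstanceAs (Decidable (v ∈ S))
  | some v, none => inferInstanceAs (Decidable (v ∈ S))
  | some v, some w => inferInstanceAs (Decidable (G.Adj v w))

instance {V W : Type*} (G : SimpleGraph V) (H : SimpleGraph W) [DecidableRel G.Adj]
    [DecidableRel H.Adj] : DecidableRel (G ⊕g H).Adj
  | .inl v, .inl w => inferInstanceAs (Decidable (G.Adj v w))
  | .inl _, .inr _ => .isFalse (by simp)
  | .inr _, .inl _ => .isFalse (by simp)
  | .inr v, .inr w => inferInstanceAs (Decidable (H.Adj v w))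

instance (V W : Type*) : DecidableRel (completeBipartiteGraph V W).Adj
  | .inl _, .inl _ => .isFalse (by simp)
  | .inl _, .inr _ => .isTrue (by simp)
  | .inr _, .inl _ => .isTrue (by simp)
  | .inr _, .inr _ => .isFalse (by simp)

instance (t ℓ : ℕ) : DecidableRel (graphL t ℓ).Adj := by
  have : DecidablePred (· ∈ ({x | match x with
      | .inl i => i.val < ℓ
      | .inr _ => True} : Set (Fin 3 ⊕ Fin t))) := fun x =>
    match x with
    | .inl i => inferInstanceAs (Decidable (i.val < ℓ))
    | .inr _ => inferInstanceAs (Decidable True)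
  unfold graphL
  infer_instance

instance (k t ℓ : ℕ) : DecidableRel (graphK' k t ℓ).Adj := by
  have : DecidablePred (· ∈ ({x | match x with
      | .inl (.inl _) => True
      | .inl (.inr i) => i.val < ℓ
      | .inr _ => True} : Set ((Fin 1 ⊕ Fin k) ⊕ Fin t))) := fun x =>
    match x with
    | .inl (.inl _) => inferInstanceAs (Decidable True)
    | .inl (.inr i) => inferInstanceAs (Decidable (i.val < ℓ))
    | .inr _ => inferInstanceAs (Decidable True)
  unfold graphK'
  infer_instance

instance : DecidableRel bowtie.Adj := by
  have : DecidablePred (· ∈ (Set.univ : Set (Fin 2 ⊕ Fin 2))) := fun _ => .isTrue trivial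
  unfold bowtie
  infer_instance

instance : DecidableRel bipartitePlusEdge.Adj := fun v w =>
  decidable_of_iff ((completeBipartiteGraph (Fin 2) (Fin 3)).Adj v w ∨
    (v = .inr 0 ∧ w = .inr 1 ∨ v = .inr 1 ∧ w = .inr 0)) (by
      simp only [bipartitePlusEdge, SimpleGraph.sup_adj, SimpleGraph.edge_adj]
      grind)

theorem graphL_two_adj_none (t : ℕ) (x : Fin 3 ⊕ Fin t) :
    (graphL t 2).Adj none (some x) ↔ x ≠ .inl 2 := by
  rcases x with i | j
  · fin_cases i <;> simp [graphL, addVertex]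
  · simp [graphL, addVertex]

theorem graphL_adj_some_some (t ℓ : ℕ) (x y : Fin 3 ⊕ Fin t) :
    (graphL t ℓ).Adj (some x) (some y) ↔ ∃ i j, x = .inl i ∧ y = .inl j ∧ i ≠ j := by
  rcases x with i | i <;> rcases y with j | j <;> simp [graphL, addVertex]

theorem noThreeMatching_graphL (t : ℕ) : NoThreeMatching (graphL t 2) := by
  intro a b c d x y h1 h2 h3
  rcases a with _ | a <;> rcases b with _ | b <;> rcases c with _ | c <;> rcases d with _ | d <;>
    rcases x with _ | x <;> rcases y with _ | y <;>
    simp only [graphL_adj_some_some, ne_eq, SimpleGraph.irrefl, not_true_eq_false, reduceCtorEq,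
      not_false_eq_true, false_imp_iff, imp_true_iff, Option.some.injEq] at h1 h2 h3 ⊢ <;>
    grind

theorem degree_eq_sum_ite {V : Type*} [Fintype V] (G : SimpleGraph V) [DecidableRel G.Adj] (v : V) :
    G.degree v = ∑ w, if G.Adj v w then 1 else 0 := by
  simpa using G.degree_eq_sum_if_adj (R := ℕ) v

theorem degree_graphL_none (t : ℕ) : (graphL t 2).degree none = t + 2 := by
  simp only [degree_eq_sum_ite, Fintype.sum_option, graphL_two_adj_none, Fintype.sum_sum_type]
  simp [Fin.sum_univ_three, add_comm]

theorem degree_graphL_inl (t : ℕ) (i : Fin 3) :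
    (graphL t 2).degree (some (.inl i)) = if i = 2 then 2 else 3 := by
  simp only [degree_eq_sum_ite, Fintype.sum_option, (graphL t 2).adj_comm _ none,
    graphL_two_adj_none, Fintype.sum_sum_type, graphL_adj_some_some]
  fin_cases i <;> simp [Fin.sum_univ_three]

theorem degree_graphL_inr (t : ℕ) (i : Fin t) :
    (graphL t 2).degree (some (.inr i)) = 1 := by
  simp only [degree_eq_sum_ite, Fintype.sum_option, (graphL t 2).adj_comm _ none,
    graphL_two_adj_none, Fintype.sum_sum_type, graphL_adj_some_some]
  simp

theorem sum_degree_graphL (t : ℕ) (f : ℕ → ℕ) :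
    ∑ v, f ((graphL t 2).degree v) = f (t + 2) + 2 * f 3 + f 2 + t * f 1 := by
  simp [Fintype.sum_option, degree_graphL_none, degree_graphL_inl, degree_graphL_inr,
    Fin.sum_univ_three]
  ring

theorem noThreeMatching_of_cover {V : Type*} {G : SimpleGraph V} (u v : V)
    (h : ∀ x y, G.Adj x y → x = u ∨ x = v ∨ y = u ∨ y = v) : NoThreeMatching G := by
  intro a b c d x y h1 h2 h3
  have := h _ _ h1
  have := h _ _ h2
  have := h _ _ h3
  grind

theorem noThreeMatching_of_card_lt [Fintype V] {G : SimpleGraph V} (h : Fintype.card V < 6) :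
    NoThreeMatching G := by
  classical
  intro a b c d x y h1 h2 h3 h4 h5 h6 h7 h8 h9 h10 h11 h12 h13 h14 h15
  have : ({a, b, c, d, x, y} : Finset V).card = 6 := by
    have := h1.ne
    have := h2.ne
    have := h3.ne
    simp [*]
  have := Finset.card_le_univ ({a, b, c, d, x, y} : Finset V)
  omega

theorem NoThreeMatching.sum_isolated {V : Type*} {G : SimpleGraph V} (h : NoThreeMatching G)
    (n : ℕ) : NoThreeMatching (G ⊕g isolated n) := by
  intro a b c d x y h1 h2 h3
  rcases a with a | a <;> rcases b with b | b <;> rcases c with c | c <;> rcases d with d | d <;>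
    rcases x with x | x <;> rcases y with y | y <;> simp at h1 h2 h3
  simpa using h a b c d x y h1 h2 h3

theorem noThreeMatching_graphK' (k t ℓ : ℕ) : NoThreeMatching (graphK' k t ℓ) := by
  refine noThreeMatching_of_cover none (some (.inl (.inl 0))) ?_
  rintro (_ | ((i | i) | i)) (_ | ((j | j) | j)) h <;> simp [graphK', addVertex] at h ⊢ <;> omega

theorem isEmpty_iso_of_degree_ne {V W : Type*} [Fintype V] [Fintype W]
    {G : SimpleGraph V} {H : SimpleGraph W} [DecidableRel G.Adj] [DecidableRel H.Adj] (v : V)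
    (h : ∀ w, H.degree w ≠ G.degree v) : IsEmpty (G ≃g H) :=
  ⟨fun f => h (f v) (f.degree_eq v)⟩

theorem comatching_of_degrees {W : Type*} [Fintype W] [DecidableEq W] {t : ℕ}
    {H : SimpleGraph W} [DecidableRel H.Adj] (hc : Fintype.card W = t + 4)
    (h1 : ∑ w, H.degree w = 2 * t + 10)
    (h2 : ∑ w, (H.degree w).choose 2 = (t + 2).choose 2 + 7)
    (hH : NoThreeMatching H) (hd : IsEmpty (graphL t 2 ≃g H)) : Comatching (graphL t 2) H := by
  refine ⟨hd, matchingPoly_eq_of_degrees ?_ ?_ ?_ (noThreeMatching_graphL t) hH⟩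
  · rw [hc]
    simp
    ring
  · rw [h1, sum_degree_graphL t fun d => d]
    ring
  · rw [h2, sum_degree_graphL t fun d => d.choose 2]
    simp [Nat.choose]

theorem comatching_bowtie : Comatching (graphL 1 2) bowtie := by
  refine comatching_of_degrees rfl (by decide) (by decide)
    (noThreeMatching_of_card_lt (by decide)) ?_
  -- The shared vertex has degree 4, while L(1,2) has maximum degree 3.
  have := isEmpty_iso_of_degree_ne (G := bowtie) (H := graphL 1 2) none (by decide)
  exact ⟨fun f => this.false f.symm⟩

theorem comatching_bipartitePlusEdge :
    Comatching (graphL 2 2) (bipartitePlusEdge ⊕g isolated 1) :=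
  comatching_of_degrees rfl (by decide) (by decide)
    ((noThreeMatching_of_card_lt (by decide)).sum_isolated 1)
    (isEmpty_iso_of_degree_ne none (by decide))

theorem comatching_graphL_four : Comatching (graphL 4 2) (graphK' 4 2 2) :=
  comatching_of_degrees rfl (by decide) (by decide) (noThreeMatching_graphK' _ _ _)
    (isEmpty_iso_of_degree_ne none (by decide))

theorem comatching_graphL_five : Comatching (graphL 5 2) (graphK' 4 2 3 ⊕g isolated 1) :=
  comatching_of_degrees rfl (by decide) (by decide)
    ((noThreeMatching_graphK' _ _ _).sum_isolated _)
    (isEmpty_iso_of_degree_ne none (by decide))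

theorem comatching_graphL_six : Comatching (graphL 6 2) (graphK' 4 2 4 ⊕g isolated 2) :=
  comatching_of_degrees rfl (by decide) (by decide)
    ((noThreeMatching_graphK' _ _ _).sum_isolated _)
    (isEmpty_iso_of_degree_ne none (by decide))

theorem comatching_graphL_six' : Comatching (graphL 6 2) (graphK' 5 0 5 ⊕g isolated 3) :=
  comatching_of_degrees rfl (by decide) (by decide)
    ((noThreeMatching_graphK' _ _ _).sum_isolated _)
    (isEmpty_iso_of_degree_ne none (by decide))

end Concrete

/-! ### Excluding or identifying each shape from the degree data. -/

section Unique

variable {W : Type*} [Fintype W] [DecidableEq W] (H : SimpleGraph W) [DecidableRel H.Adj]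

/-- The degree data that the matching polynomial of `L(t, 2)` determines. -/
structure HasLData (t : ℕ) : Prop where
  card : Fintype.card W = t + 4
  sum_degree : ∑ w, H.degree w = 2 * t + 10
  sum_choose : ∑ w, (H.degree w).choose 2 = (t + 2).choose 2 + 7

variable {H}

/-- Convexity of C(d,2): the bound is the chord through d = 3 and d = 4. -/
theorem choose_two_ge (d : ℕ) : 3 * d ≤ d.choose 2 + 6 := by
  rw [Nat.choose_two_right]
  rcases d with _ | _ | _ | _ | d
  · simp
  · simp
  · simp
  · simp
  · have : (d + 1 + 1 + 1 + 1) * (d + 1 + 1 + 1 + 1 - 1) / 2 = (d * d + 7 * d) / 2 + 6 := by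
      simp only [Nat.add_sub_cancel]
      rw [← Nat.add_mul_div_right _ _ (by norm_num)]
      congr 1
      ring
    rw [this]
    have : 6 * d ≤ d * d + 7 * d := by nlinarith
    omega

theorem two_mul_choose_two (d : ℕ) : 2 * ((d.choose 2 : ℕ) : ℤ) = d * (d - 1) := by
  rcases d with _ | d
  · simp
  · have h := Nat.add_one_mul_choose_eq d 1
    simp only [Nat.choose_one_right] at h
    have : ((d + 1 : ℕ) : ℤ) * d = ((d + 1).choose 2 : ℕ) * 2 := by exact_mod_cast h
    push_cast at this ⊢
    linarith

omit [DecidableEq W] in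
theorem sum_degree_le_of_subset (S : Finset W) (D : ℕ) (hS : ∀ x y, H.Adj x y → x ∈ S)
    (hD : ∀ x ∈ S, H.degree x ≤ D) : ∑ w, H.degree w ≤ S.card * D := by
  rw [← Finset.sum_subset (Finset.subset_univ S)]
  · exact Finset.sum_le_card_nsmul _ _ _ hD
  · intro x _ hx
    rw [SimpleGraph.degree_eq_zero_iff_notMem_support]
    rintro ⟨y, hy⟩
    exact hx (hS x y hy)

omit [DecidableEq W] in
theorem degree_le_of_subset (T : Finset W) (x : W) (h : ∀ y, H.Adj x y → y ∈ T) :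
    H.degree x ≤ T.card := by
  rw [← H.card_neighborFinset_eq_degree]
  exact Finset.card_le_card fun y hy => h y (by simpa using hy)

theorem HasLData.not_within_five {t : ℕ} (h : HasLData H t) (ht : t = 3 ∨ 7 ≤ t) (a b c d x : W)
    (hS : ∀ y z, H.Adj y z → y = a ∨ y = b ∨ y = c ∨ y = d ∨ y = x) : False := by
  set S : Finset W := {a, b, c, d, x} with hSdef
  have hS' : ∀ y z, H.Adj y z → y ∈ S := fun y z hyz => by simpa [hSdef] using hS y z hyz
  have hc : S.card ≤ 5 := Finset.card_le_five
  have hdeg : ∀ y ∈ S, H.degree y ≤ 4 := by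
    intro y hy
    refine (degree_le_of_subset (S.erase y) y fun z hz => ?_).trans ?_
    · exact Finset.mem_erase.2 ⟨hz.ne.symm, hS' z y hz.symm⟩
    · rw [Finset.card_erase_of_mem hy]
      omega
  have h1 := sum_degree_le_of_subset S 4 hS' hdeg
  rw [h.sum_degree] at h1
  obtain rfl : t = 3 := by omega
  have h0 : ∀ y ∉ S, H.degree y = 0 := by
    intro y hy
    have := degree_le_of_subset (H := H) ∅ y fun z hz => absurd (hS' y z hz) hy
    simpa using this
  have h2 : ∑ y ∈ S, H.degree y = 16 := by
    rw [Finset.sum_subset (Finset.subset_univ S) fun y _ hy => h0 y hy, h.sum_degree]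
  have h3 : ∑ y ∈ S, (H.degree y).choose 2 = 17 := by
    rw [Finset.sum_subset (Finset.subset_univ S) fun y _ hy => by rw [h0 y hy]; rfl, h.sum_choose]
    rfl
  -- Summed over at most five vertices this reads 3 · 16 ≤ 17 + 6 · 5, which is false.
  have h4 := Finset.sum_le_sum fun y (_ : y ∈ S) => choose_two_ge (H.degree y)
  rw [← Finset.mul_sum, Finset.sum_add_distrib, h2, h3, Finset.sum_const, smul_eq_mul] at h4
  omega

theorem HasLData.not_within_triangles {t : ℕ} (h : HasLData H t) (ht : t = 3 ∨ 7 ≤ t)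
    (a b c p q r : W) (hS : ∀ x y, H.Adj x y →
      ((x = a ∨ x = b ∨ x = c) ∧ (y = a ∨ y = b ∨ y = c)) ∨
      ((x = p ∨ x = q ∨ x = r) ∧ (y = p ∨ y = q ∨ y = r))) : False := by
  have hsum : ∑ w, H.degree w ≤ ∑ w, ((if w ∈ ({a, b, c} : Finset W) then 2 else 0) +
      if w ∈ ({p, q, r} : Finset W) then 2 else 0) := by
    refine Finset.sum_le_sum fun w _ => ?_
    have hsub : H.neighborFinset w ⊆ (if w ∈ ({a, b, c} : Finset W) then
        ({a, b, c} : Finset W).erase w else ∅) ∪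
        (if w ∈ ({p, q, r} : Finset W) then ({p, q, r} : Finset W).erase w else ∅) := by
      intro z hz
      rw [SimpleGraph.mem_neighborFinset] at hz
      have := hz.ne
      rcases hS w z hz with h1 | h1
      · exact Finset.mem_union_left _ (by simp [h1, this.symm])
      · exact Finset.mem_union_right _ (by simp [h1, this.symm])
    rw [← H.card_neighborFinset_eq_degree]
    refine (Finset.card_le_card hsub).trans ((Finset.card_union_le _ _).trans (add_le_add ?_ ?_))
    all_goals
      split_ifs with hw
      · have : ∀ u v w : W, ({u, v, w} : Finset W).card ≤ 3 := fun _ _ _ => Finset.card_le_three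
        have h1 := this a b c
        have h2 := this p q r
        rw [Finset.card_erase_of_mem hw]
        omega
      · simp
  rw [h.sum_degree, Finset.sum_add_distrib, ← Finset.sum_filter, ← Finset.sum_filter] at hsum
  have : ∀ u v w : W, ({u, v, w} : Finset W).card ≤ 3 := fun _ _ _ => Finset.card_le_three
  have h1 := this a b c
  have h2 := this p q r
  simp only [Finset.filter_mem_eq_inter, Finset.univ_inter, Finset.sum_const, smul_eq_mul] at hsum
  -- Two triples carry total degree at most 12, but 2t + 10 ≥ 16.
  omega

/-- For a covering pair, A and B count the neighbors outside the pair, c the common ones, and ε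
records the edge inside it. Since A, B ≥ c, the product is at least (c - 3)² once c ≥ 3, outgrowing
the linear right side. -/
theorem cover_arith {t A B c ε : ℤ} (ht : t = 3 ∨ 7 ≤ t) (hε : ε = 0 ∨ ε = 1)
    (he : A + B + ε = t + 5) (hA : c ≤ A) (hB : c ≤ B) (hn : A + B - c ≤ t + 2)
    (h : (A - 3) * (B - 3) = c + 3 * ε - 4) : False := by
  have hc : 3 - ε ≤ c := by omega
  rcases hε with rfl | rfl
  · have : (c - 3) * (c - 3) ≤ (A - 3) * (B - 3) := by apply mul_le_mul <;> omega
    -- (c - 3)² ≤ c - 4 would mean (2c - 7)² + 3 ≤ 0.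
    nlinarith [sq_nonneg (2 * c - 7)]
  have hc6 : c ≤ 5 := by
    by_contra hc6
    have : (c - 3) * (c - 3) ≤ (A - 3) * (B - 3) := by apply mul_le_mul <;> omega
    nlinarith
  have hA' : A ≤ c + 2 := by
    have := Int.le_of_dvd (by omega) (Dvd.intro _ h)
    omega
  -- The surviving solutions have t in {0, 4, 5, 6}.
  interval_cases c <;> interval_cases A <;> omega

theorem sum_eq_two_add {M : Type*} [AddCommMonoid M] {u v : W} (huv : u ≠ v) (f : W → M) :
    ∑ w, f w = f u + f v + ∑ w ∈ Finset.univ \ {u, v}, f w := by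
  rw [← Finset.sum_sdiff (Finset.subset_univ {u, v}), Finset.sum_pair huv, add_comm]

theorem HasLData.not_cover {t : ℕ} (h : HasLData H t) (ht : t = 3 ∨ 7 ≤ t) {u v : W}
    (huv : u ≠ v) (hS : ∀ x y, H.Adj x y → x = u ∨ x = v ∨ y = u ∨ y = v) : False := by
  set R : Finset W := Finset.univ \ {u, v} with hR
  have hRu : ∀ w ∈ R, w ≠ u ∧ w ≠ v := fun w hw => by simpa [hR] using hw
  set A := ∑ w ∈ R, (if H.Adj u w then 1 else 0) with hA
  set B := ∑ w ∈ R, (if H.Adj v w then 1 else 0) with hB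
  set c := ∑ w ∈ R, (if H.Adj u w ∧ H.Adj v w then 1 else 0) with hc
  set ε := if H.Adj u v then 1 else 0 with hε
  have hdu : H.degree u = ε + A := by
    rw [degree_eq_sum_ite, sum_eq_two_add huv]
    simp [hε, hA, hR]
  have hdv : H.degree v = ε + B := by
    rw [degree_eq_sum_ite, sum_eq_two_add huv]
    simp [hε, hB, hR, H.adj_comm]
  have hdw : ∀ w ∈ R, H.degree w = (if H.Adj u w then 1 else 0) + if H.Adj v w then 1 else 0 := by
    intro w hw
    rw [degree_eq_sum_ite, sum_eq_two_add huv, Finset.sum_eq_zero]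
    · simp [H.adj_comm]
    · intro x hx
      have := hS w x
      have := hRu w hw
      have := hRu x hx
      grind
  have h1 := h.sum_degree
  rw [sum_eq_two_add huv, Finset.sum_congr rfl hdw, Finset.sum_add_distrib, ← hA, ← hB,
    hdu, hdv] at h1
  have h2 := h.sum_choose
  have hcw : ∀ w ∈ R, (H.degree w).choose 2 = if H.Adj u w ∧ H.Adj v w then 1 else 0 := by
    intro w hw
    rw [hdw w hw]
    by_cases h3 : H.Adj u w <;> by_cases h4 : H.Adj v w <;> simp [h3, h4]
  rw [sum_eq_two_add huv, Finset.sum_congr rfl hcw, ← hc, hdu, hdv] at h2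
  have hcA : c ≤ A := Finset.sum_le_sum fun w _ => by split_ifs <;> simp_all
  have hcB : c ≤ B := Finset.sum_le_sum fun w _ => by split_ifs <;> simp_all
  have hRc : R.card = t + 2 := by
    rw [hR, Finset.card_univ_sdiff, Finset.card_pair huv, h.card]
    rfl
  have hn : A + B ≤ c + (t + 2) := by
    rw [← hRc, Finset.card_eq_sum_ones, hA, hB, hc, ← Finset.sum_add_distrib,
      ← Finset.sum_add_distrib]
    exact Finset.sum_le_sum fun w _ => by split_ifs <;> simp_all
  have hε' : ε = 0 ∨ ε = 1 := by
    rw [hε]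
    split_ifs <;> simp
  clear_value A B c ε R
  have i1 := two_mul_choose_two (ε + A)
  have i2 := two_mul_choose_two (ε + B)
  have i3 := two_mul_choose_two (t + 2)
  zify at h1 h2 hcA hcB hn
  refine cover_arith (t := t) (A := A) (B := B) (c := c) (ε := ε) (by omega) (by omega) (by omega)
    hcA hcB (by omega) ?_
  have h3 : (t : ℤ) = A + B + ε - 5 := by omega
  have h4 := congrArg (fun z => 2 * z) h2
  simp only [mul_add, i1, i2, i3] at h4
  push_cast at h4
  rw [h3] at h4
  -- Idempotence of ε removes the quadratic term, leaving the factored equation.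
  have h5 : (ε : ℤ) * ε = ε := by rcases hε' with h | h <;> simp [h]
  nlinarith

omit [DecidableRel H.Adj] in
theorem nonempty_iso_graphL {t : ℕ} (hc : Fintype.card W = t + 4) {v p q r : W}
    (hvr : v ≠ r) (hp : H.Adj v p) (hq : H.Adj v q) (hr : ¬ H.Adj v r)
    (hpq : H.Adj p q) (hpr : H.Adj p r) (hqr : H.Adj q r)
    (hv : ∀ w, w ≠ v → w ≠ r → H.Adj v w)
    (hS : ∀ x y, H.Adj x y → x = v ∨ y = v ∨
      ((x = p ∨ x = q ∨ x = r) ∧ (y = p ∨ y = q ∨ y = r))) : Nonempty (graphL t 2 ≃g H) := by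
  set R : Finset W := Finset.univ \ {v, p, q, r} with hR
  have hRc : R.card = t := by
    have : ({v, p, q, r} : Finset W).card = 4 := by
      simp [hvr, hp.ne, hq.ne, hpq.ne, hpr.ne, hqr.ne]
    rw [hR, Finset.card_univ_sdiff, this, hc]
    rfl
  have hRn : ∀ w ∈ R, w ≠ v ∧ w ≠ p ∧ w ≠ q ∧ w ≠ r := fun w hw => by simpa [hR] using hw
  let e := (R.equivFinOfCardEq hRc).symm
  have he : ∀ i, (e i : W) ≠ v ∧ (e i : W) ≠ p ∧ (e i : W) ≠ q ∧ (e i : W) ≠ r := fun i =>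
    hRn _ (e i).2
  let f : Option (Fin 3 ⊕ Fin t) → W
    | none => v
    | some (.inl i) => ![p, q, r] i
    | some (.inr i) => e i
  have hfv : ∀ i, ![p, q, r] i ≠ v := by
    intro i
    fin_cases i
    exacts [hp.ne.symm, hq.ne.symm, hvr.symm]
  have hadj : ∀ i j, i ≠ j → H.Adj (![p, q, r] i) (![p, q, r] j) := by
    intro i j hij
    fin_cases i <;> fin_cases j <;> simp [hpq, hpr, hqr, hpq.symm, hpr.symm, hqr.symm] at hij ⊢
  have hfe : ∀ i j, ![p, q, r] i ≠ e j := by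
    intro i j
    have := he j
    fin_cases i
    exacts [this.2.1.symm, this.2.2.1.symm, this.2.2.2.symm]
  have hinj : Function.Injective f := by
    rintro (_ | i | i) (_ | j | j) hij
    · rfl
    · exact (hfv j hij.symm).elim
    · exact ((he j).1 hij.symm).elim
    · exact (hfv i hij).elim
    · by_contra hne
      exact (hadj i j fun h => hne (by rw [h])).ne hij
    · exact (hfe i j hij).elim
    · exact ((he i).1 hij).elim
    · exact (hfe j i hij.symm).elim
    · rw [e.injective (Subtype.ext hij)]
  have hbij : Function.Bijective f := by
    rw [Fintype.bijective_iff_injective_and_card]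
    refine ⟨hinj, ?_⟩
    rw [hc]
    simp
    ring
  have hnone : ∀ x, H.Adj v (f (some x)) ↔ x ≠ .inl 2 := by
    rintro (i | i)
    · fin_cases i <;> simp [f, hp, hq, hr]
    · simpa using hv _ (he i).1 (he i).2.2.2
  have hout : ∀ i x, ¬ H.Adj (f (some (.inr i))) (f (some x)) := by
    intro i x hix
    rcases hS _ _ hix with h | h | h
    · exact (he i).1 h
    · exact absurd (hinj (a₂ := none) h) (by simp)
    · have := he i
      have h1 := h.1
      simp only [f] at h1
      tauto
  refine ⟨⟨Equiv.ofBijective f hbij, ?_⟩⟩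
  rintro (_ | x) (_ | y)
  · simp
  · rw [graphL_two_adj_none]
    exact hnone y
  · rw [SimpleGraph.adj_comm, SimpleGraph.adj_comm _ (some x), graphL_two_adj_none]
    exact hnone x
  · rw [graphL_adj_some_some]
    simp only [Equiv.ofBijective_apply]
    rcases x with i | i
    · rcases y with j | j
      · simp only [Sum.inl.injEq]
        constructor
        · intro h
          refine ⟨i, j, rfl, rfl, ?_⟩
          rintro rfl
          exact H.irrefl h
        · rintro ⟨i, j, rfl, rfl, hij⟩
          exact hadj i j hij
      · simpa using fun h => hout j (.inl i) (H.adj_symm h)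
    · simpa using hout i y

/-- A missing edge of pqr would give a two-vertex cover, so the triangle is complete. Then ∑ deg
forces deg v = t + 2, and ∑ C(deg,2) forces v to have exactly two neighbors in the triangle; its
other t neighbors exhaust the remaining vertices. -/
theorem HasLData.nonempty_iso {t : ℕ} (h : HasLData H t) (ht : t = 3 ∨ 7 ≤ t) {v p q r : W}
    (hvp : v ≠ p) (hvq : v ≠ q) (hvr : v ≠ r) (hpq : p ≠ q) (hpr : p ≠ r) (hqr : q ≠ r)
    (hS : ∀ x y, H.Adj x y → x = v ∨ y = v ∨
      ((x = p ∨ x = q ∨ x = r) ∧ (y = p ∨ y = q ∨ y = r))) : Nonempty (graphL t 2 ≃g H) := by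
  have hpq' : H.Adj p q := by
    by_contra hn
    exact h.not_cover ht hvr (by grind [H.adj_comm, H.irrefl])
  have hpr' : H.Adj p r := by
    by_contra hn
    exact h.not_cover ht hvq (by grind [H.adj_comm, H.irrefl])
  have hqr' : H.Adj q r := by
    by_contra hn
    exact h.not_cover ht hvp (by grind [H.adj_comm, H.irrefl])
  set R : Finset W := Finset.univ \ {v, p, q, r} with hR
  have hRn : ∀ w ∈ R, w ≠ v ∧ w ≠ p ∧ w ≠ q ∧ w ≠ r := fun w hw => by simpa [hR] using hw
  have hsum : ∀ f : W → ℕ, ∑ w, f w = f v + f p + f q + f r + ∑ w ∈ R, f w := by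
    intro f
    rw [← Finset.sum_sdiff (Finset.subset_univ {v, p, q, r}), Finset.sum_insert, Finset.sum_insert,
      Finset.sum_pair hqr, ← hR]
    · ring
    all_goals simp [*]
  have hRc : R.card = t := by
    have : ({v, p, q, r} : Finset W).card = 4 := by simp [*]
    rw [hR, Finset.card_univ_sdiff, this, h.card]
    rfl
  have hRadj : ∀ w ∈ R, ∀ x, x ≠ v → ¬ H.Adj w x := by
    intro w hw x hx hwx
    have := hRn w hw
    have := hS w x hwx
    tauto
  have hdv : H.degree v = (if H.Adj v p then 1 else 0) + (if H.Adj v q then 1 else 0) +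
      (if H.Adj v r then 1 else 0) + ∑ w ∈ R, if H.Adj v w then 1 else 0 := by
    rw [degree_eq_sum_ite, hsum, if_neg (H.irrefl), zero_add]
  have hin : ∀ x, x ≠ v → ∑ w ∈ R, (if H.Adj x w then 1 else 0) = 0 := fun x hx =>
    Finset.sum_eq_zero fun w hw => if_neg fun hxw => hRadj w hw x hx hxw.symm
  have hdp : H.degree p = 2 + if H.Adj v p then 1 else 0 := by
    rw [degree_eq_sum_ite, hsum, hin p hvp.symm]
    simp [hpq', hpr', H.adj_comm p v]
    ring
  have hdq : H.degree q = 2 + if H.Adj v q then 1 else 0 := by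
    rw [degree_eq_sum_ite, hsum, hin q hvq.symm]
    simp [hpq'.symm, hqr', H.adj_comm q v]
    ring
  have hdr : H.degree r = 2 + if H.Adj v r then 1 else 0 := by
    rw [degree_eq_sum_ite, hsum, hin r hvr.symm]
    simp [hpr'.symm, hqr'.symm, H.adj_comm r v]
    ring
  have hdw : ∀ w ∈ R, H.degree w = if H.Adj v w then 1 else 0 := by
    intro w hw
    have := hRadj w hw
    rw [degree_eq_sum_ite, hsum, if_neg (this p hvp.symm), if_neg (this q hvq.symm),
      if_neg (this r hvr.symm), Finset.sum_eq_zero]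
    · simp [H.adj_comm]
    intro x hx
    exact if_neg (this x (hRn x hx).1)
  have hcw : ∀ w ∈ R, (H.degree w).choose 2 = 0 := by
    intro w hw
    rw [hdw w hw]
    split_ifs <;> rfl
  have h1 := h.sum_degree
  have h2 := h.sum_choose
  rw [hsum, Finset.sum_congr rfl hdw, hdp, hdq, hdr] at h1
  have hD : H.degree v = t + 2 := by omega
  rw [hsum, Finset.sum_eq_zero hcw, hdp, hdq, hdr, hD] at h2
  have hch : ∀ P : Prop, ∀ [Decidable P],
      (2 + if P then 1 else 0).choose 2 = 1 + 2 * if P then 1 else 0 := by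
    intro P _
    split_ifs <;> rfl
  rw [hch, hch, hch] at h2
  have hA : ∑ w ∈ R, (if H.Adj v w then 1 else 0) = t := by omega
  have hall : ∀ w ∈ R, H.Adj v w := by
    rw [Finset.sum_boole, Nat.cast_id, ← hRc, Finset.card_filter_eq_iff] at hA
    exact hA
  have hv : ∀ w, w ≠ v → w ≠ p → w ≠ q → w ≠ r → H.Adj v w := fun w h1 h2 h3 h4 =>
    hall w (by simp [*])
  by_cases hp : H.Adj v p <;> by_cases hq : H.Adj v q <;> by_cases hr : H.Adj v r <;>
    simp only [hp, hq, hr, if_true, if_false] at h2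
  -- Only the cases with exactly two neighbors survive; they differ by which triangle vertex v
  -- misses.
  all_goals first | omega | skip
  · exact nonempty_iso_graphL h.card hvr hp hq hr hpq' hpr' hqr' (by grind) hS
  · exact nonempty_iso_graphL h.card hvq hp hr hq hpr' hpq' hqr'.symm (by grind) (by grind)
  · exact nonempty_iso_graphL h.card hvp hq hr hp hqr' hpq'.symm hpr'.symm (by grind) (by grind)

theorem HasLData.nonempty_iso_of_shape {t : ℕ} (h : HasLData H t) (ht : t = 3 ∨ 7 ≤ t)
    (hS : SmallMatchingShape H) : Nonempty (graphL t 2 ≃g H) := by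
  rcases hS with ⟨u, v, hS⟩ | ⟨v, p, q, r, h1, h2, h3, h4, h5, h6, hS⟩ | ⟨a, b, c, d, x, hS⟩ |
    ⟨a, b, c, p, q, r, hS⟩
  · exfalso
    by_cases huv : u = v
    · subst huv
      -- A one-vertex cover becomes a pair by adding any second vertex.
      have : Nontrivial W := Fintype.one_lt_card_iff_nontrivial.1 (by rw [h.card]; omega)
      obtain ⟨w, hw⟩ := exists_ne u
      exact h.not_cover ht hw.symm fun x y hxy => by grind
    · exact h.not_cover ht huv hS
  · exact h.nonempty_iso ht h1 h2 h3 h4 h5 h6 hS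
  · exact (h.not_within_five ht a b c d x hS).elim
  · exact (h.not_within_triangles ht a b c p q r hS).elim

end Unique

theorem matchingUnique_graphL {t : ℕ} (ht : t = 3 ∨ 7 ≤ t) : MatchingUnique (graphL t 2) := by
  classical
  rintro W _ H ⟨hiso, hpoly⟩
  have hcL : Fintype.card (Option (Fin 3 ⊕ Fin t)) = t + 4 := by
    simp
    ring
  have hm := fun k hk => numMatchings_eq_of_matchingPoly_eq hpoly (k := k) hk
  rw [hcL] at hm
  have h1 := hm 1 (by omega)
  have h2 := hm 2 (by omega)
  -- The polynomial has a term for 3-matchings because t + 4 ≥ 6.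
  have h3 := hm 3 (by omega)
  rw [(noThreeMatching_graphL t).numMatchings_eq_zero le_rfl] at h3
  rw [numMatchings_one, numMatchings_one] at h1
  have i1 := sum_degree_graphL t fun d => d
  have i2 := sum_degree_graphL t fun d => d.choose 2
  simp only [SimpleGraph.sum_degrees_eq_twice_card_edges] at i1
  have e1 := numMatchings_two_add_sum_choose (graphL t 2)
  have e2 := numMatchings_two_add_sum_choose H
  rw [i2, h1, h2] at e1
  simp only [Nat.choose] at e1
  have hL : HasLData H t := by
    refine ⟨?_, ?_, ?_⟩
    · rw [← card_eq_of_matchingPoly_eq hpoly, hcL]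
    · rw [SimpleGraph.sum_degrees_eq_twice_card_edges]
      omega
    · simp only [Nat.choose]
      omega
  -- Otherwise C(t+5,2) = C(t+2,2) + 7, whereas the two binomials differ by 3t + 9.
  have hne : numMatchings H 2 ≠ 0 := by
    intro h0
    have h7 := two_mul_choose_two (t + 5)
    have h8 := two_mul_choose_two (t + 2)
    have h5 : H.edgeFinset.card = t + 5 := by omega
    have h6 := hL.sum_choose
    rw [h5] at e2
    zify at e2 h6 h0
    push_cast at *
    nlinarith
  obtain ⟨a, b, c, d, hab, hcd, hac, had, hbc, hbd⟩ := exists_disjoint_adj_of_numMatchings_two hne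
  have hshape := (noThreeMatching_of_numMatchings h3.symm).shape hab hcd hac had hbc hbd
  exact not_isEmpty_iff.2 (hL.nonempty_iso_of_shape ht hshape) hiso

end MatchingGraphs

theorem mainTheorem4 :
    (∀ t : ℕ, 0 < t → (MatchingUnique (graphL t 2) ↔ t ∉ ({1, 2, 4, 5, 6} : Set ℕ))) ∧
      Comatching (graphL 1 2) bowtie ∧
      Comatching (graphL 2 2) (bipartitePlusEdge ⊕g isolated 1) ∧
      Comatching (graphL 4 2) (graphK' 4 2 2) ∧
      Comatching (graphL 5 2) (graphK' 4 2 3 ⊕g isolated 1) ∧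
      Comatching (graphL 6 2) (graphK' 4 2 4 ⊕g isolated 2) ∧
      Comatching (graphL 6 2) (graphK' 5 0 5 ⊕g isolated 3) := by
  refine ⟨fun t ht => ⟨fun h => ?_, fun h => ?_⟩, comatching_bowtie, comatching_bipartitePlusEdge,
    comatching_graphL_four, comatching_graphL_five, comatching_graphL_six, comatching_graphL_six'⟩
  · simp only [Set.mem_insert_iff, Set.mem_singleton_iff]
    rintro (rfl | rfl | rfl | rfl | rfl)
    · exact h _ _ comatching_bowtie
    · exact h _ _ comatching_bipartitePlusEdge
    · exact h _ _ comatching_graphL_four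
    · exact h _ _ comatching_graphL_five
    · exact h _ _ comatching_graphL_six
  · simp only [Set.mem_insert_iff, Set.mem_singleton_iff, not_or] at h
    exact matchingUnique_graphL (by omega)
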